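/- Let $G=(V,E)$ be a finite simple graph on $n$ vertices. For a vertex $v$, the local complementation $G*v$ is the graph obtained from $G$ by replacing the subgraph induced on the neighbourhood of $v$ by its complement. The LC orbit of $G$ is the set of all graphs obtained from $G$ by a finite (possibly empty) sequence of local complementations. For an edge $\{u,v\}$ of $G$ put $G^{(uv)} = G*u*v*u$, and write $G\setminus u$ for $G$ with the vertex $u$ and all edges incident on it removed. The interlace polynomial $Q(G)=Q(G,x)$ is defined recursively by $Q(E_n)=x^n$ for the edgeless graph $E_n$ on $n$ vertices and, for any other graph, by $$Q(G) = Q(G\setminus u) + Q(G^{(uv)}\setminus u) + Q((G*u)\setminus u),$$ where $\{u,v\}$ is an arbitrarily chosen edge of $G$. Theorem. Let $\delta$ be the minimum vertex degree over all graphs in the LC orbit of $G$ (with $\delta = 0$ if $n=0$). Then, for a polynomial $Q(G)$ obtained from this recursion with any choice of edges, $$Q(G,4) \le \frac{\gamma(\delta+1) + 6^n}{2^n},$$ where $$\gamma(d) = \sum_{t=0}^{n} \binom{n}{t} 2^t \left( \sum_{k=\max(1,\,d+t-n)}^{t} \binom{t}{k} 2^{n-k} \right).$$ -/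

import Mathlib

open Polynomial

universe u

namespace SimpleGraph

/-- Local complementation `G * v`: the subgraph of `G` induced on the neighbourhood of `v` is
replaced by its complement, and all other pairs of vertices are left unchanged. -/
def localComplement {V : Type u} (G : SimpleGraph V) (v : V) : SimpleGraph V where
  Adj x y := x ≠ y ∧ Xor (G.Adj x y) (G.Adj v x ∧ G.Adj v y)
  symm := ⟨fun x y h => by
    rw [G.adj_comm y x, and_comm (a := G.Adj v y)]
    exact ⟨h.1.symm, h.2⟩⟩
  loopless := ⟨fun _ h => h.1 rfl⟩

/-- Edge local complementation `G^{(uv)} = G * u * v * u` (used for edges `uv` of `G`). -/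
def edgeLocalComplement {V : Type u} (G : SimpleGraph V) (u v : V) : SimpleGraph V :=
  ((G.localComplement u).localComplement v).localComplement u

/-- The graph `G \ u`: the vertex `u` and all edges incident on it are removed. -/
def removeVertex {V : Type u} (G : SimpleGraph V) (u : V) : SimpleGraph {w : V // w ≠ u} :=
  G.comap Subtype.val

/-- The LC orbit of `G`: all graphs obtained from `G` by a finite (possibly empty) sequence of
local complementations. The graphs are kept as labeled graphs on the vertex set of `G`; passing to
isomorphism classes does not affect any isomorphism invariant, such as the minimum degree. -/
def lcOrbit {V : Type u} (G : SimpleGraph V) : Set (SimpleGraph V) :=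
  {H | Relation.ReflTransGen (fun A B : SimpleGraph V => ∃ v, B = A.localComplement v) G H}

open Classical in
/-- The minimum vertex degree over all graphs in the LC orbit of `G`. -/
noncomputable def lcMinDegree {V : Type u} [Fintype V] (G : SimpleGraph V) : ℕ :=
  sInf ((fun H : SimpleGraph V => H.minDegree) '' G.lcOrbit)

/-- `IsInterlaceQ G P`: the polynomial `P` is a value `Q(G)` of the recursive definition of the
interlace polynomial `Q`, for some choice of an edge `uv` at each step of the recursion:
`Q(E_n) = x ^ n` for the edgeless graph on `n` vertices, and
`Q(G) = Q(G \ u) + Q(G^{(uv)} \ u) + Q((G * u) \ u)` for an edge `uv` of `G`. -/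
inductive IsInterlaceQ : {V : Type u} → SimpleGraph V → ℤ[X] → Prop
  | edgeless {V : Type u} [Finite V] : IsInterlaceQ (⊥ : SimpleGraph V) (X ^ Nat.card V)
  | step {V : Type u} {G : SimpleGraph V} {u v : V} (huv : G.Adj u v) {P₁ P₂ P₃ : ℤ[X]}
      (h₁ : IsInterlaceQ (G.removeVertex u) P₁)
      (h₂ : IsInterlaceQ ((G.edgeLocalComplement u v).removeVertex u) P₂)
      (h₃ : IsInterlaceQ ((G.localComplement u).removeVertex u) P₃) :
      IsInterlaceQ G (P₁ + P₂ + P₃)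

/-- The recursion for `Q` yields a polynomial for every finite graph. -/
theorem exists_isInterlaceQ {V : Type u} [Finite V] (G : SimpleGraph V) :
    ∃ P, IsInterlaceQ G P := by
  suffices H : ∀ (n : ℕ) (V : Type u) [Finite V] (G : SimpleGraph V), Nat.card V = n →
      ∃ P, IsInterlaceQ G P from H _ V G rfl
  intro n
  induction n with
  | zero =>
    intro V _ G hn
    have hV : IsEmpty V := Finite.card_eq_zero_iff.mp hn
    obtain rfl : G = ⊥ := by
      ext x
      exact isEmptyElim x
    exact ⟨_, .edgeless⟩
  | succ n ih =>
    intro V _ G hn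
    by_cases hG : G = ⊥
    · subst hG
      exact ⟨_, .edgeless⟩
    · obtain ⟨u, v, huv⟩ := SimpleGraph.ne_bot_iff_exists_adj.mp hG
      have hc : Nat.card {w : V // w ≠ u} = n := by
        have := Fintype.ofFinite V
        classical
        rw [Nat.card_eq_fintype_card] at hn ⊢
        rw [Fintype.card_subtype_compl, Fintype.card_subtype_eq, hn]
        rfl
      obtain ⟨P₁, h₁⟩ := ih _ (G.removeVertex u) hc
      obtain ⟨P₂, h₂⟩ := ih _ ((G.edgeLocalComplement u v).removeVertex u) hc
      obtain ⟨P₃, h₃⟩ := ih _ ((G.localComplement u).removeVertex u) hc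
      exact ⟨_, .step huv h₁ h₂ h₃⟩

end SimpleGraph

/-- `γ(d) = ∑_{t=0}^{n} C(n,t) 2^t ∑_{k=max(1,d+t-n)}^{t} C(t,k) 2^{n-k}`. The truncated
subtraction `d + t - n` is harmless because of the maximum with `1`, and `k ≤ t ≤ n`. -/
def interlaceGamma (n d : ℕ) : ℕ :=
  ∑ t ∈ Finset.range (n + 1), n.choose t * 2 ^ t *
    ∑ k ∈ Finset.Icc (max 1 (d + t - n)) t, t.choose k * 2 ^ (n - k)

namespace SimpleGraph

open Classical in
/-- The product `Γ a` of the adjacency matrix of `G` over `ZMod 2` with the vector `a`. -/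
noncomputable def nbrSum {V : Type u} [Fintype V] (G : SimpleGraph V) (a : V → ZMod 2) (w : V) :
    ZMod 2 :=
  ∑ x, if G.Adj w x then a x else 0

open Classical in
/-- The positions at which the codeword of the graph code indexed by `a` vanishes. -/
noncomputable def zeroSet {V : Type u} [Fintype V] (G : SimpleGraph V) (a : V → ZMod 2) :
    Finset V :=
  Finset.univ.filter fun w => a w = 0 ∧ G.nbrSum a w = 0

open Classical in
/-- The action on code words of the local complementation at `u`. -/
noncomputable def lcMap {V : Type u} [Fintype V] (G : SimpleGraph V) (u : V) (a : V → ZMod 2) :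
    V → ZMod 2 :=
  fun w => a w + if w = u then G.nbrSum a u else 0

open Classical in
/-- The weight enumerator of the graph code of `G` at `(3, 1)`. -/
noncomputable def codeSum {V : Type u} [Fintype V] (G : SimpleGraph V) : ℕ :=
  ∑ a : V → ZMod 2, ∏ w, if a w = 0 ∧ G.nbrSum a w = 0 then 3 else 1

theorem mem_lcOrbit_of_localComplement {V : Type u} {G H : SimpleGraph V} {v : V}
    (h : H ∈ (G.localComplement v).lcOrbit) : H ∈ G.lcOrbit :=
  Relation.ReflTransGen.head ⟨v, rfl⟩ h

theorem localComplement_adj_self {V : Type u} (G : SimpleGraph V) (u w : V) :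
    (G.localComplement u).Adj u w ↔ G.Adj u w := by
  have := G.ne_of_adj (a := u) (b := w)
  simp only [localComplement, Xor, SimpleGraph.irrefl]
  tauto

section

variable {V : Type u} [Fintype V] (G : SimpleGraph V)

open Classical in
theorem nbrSum_lcMap (u : V) (a : V → ZMod 2) (w : V) :
    G.nbrSum (G.lcMap u a) w = G.nbrSum a w + if G.Adj u w then G.nbrSum a u else 0 := by
  have h : ∀ x, (if G.Adj w x then G.lcMap u a x else 0) =
      (if G.Adj w x then a x else 0) +
        if x = u then (if G.Adj w x then G.nbrSum a u else 0) else 0 := by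
    intro x
    simp only [lcMap]
    split_ifs <;> simp
  rw [nbrSum, Finset.sum_congr rfl fun x _ => h x, Finset.sum_add_distrib,
    Finset.sum_ite_eq' Finset.univ u, G.adj_comm u w]
  simp [nbrSum]

theorem nbrSum_lcMap_self (u : V) (a : V → ZMod 2) :
    G.nbrSum (G.lcMap u a) u = G.nbrSum a u := by
  simp [nbrSum_lcMap]

open Classical in
theorem nbrSum_localComplement (u : V) (a : V → ZMod 2) (w : V) :
    (G.localComplement u).nbrSum a w =
      G.nbrSum a w + if G.Adj u w then G.nbrSum a u + a w else 0 := by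
  have h2 : ∀ b : ZMod 2, b + b = 0 := CharTwo.add_self_eq_zero
  have h : ∀ x, (if (G.localComplement u).Adj w x then a x else 0) =
      ((if G.Adj w x then a x else 0) +
        if G.Adj u w then (if G.Adj u x then a x else 0) else 0) +
        if x = w then (if G.Adj u w then a w else 0) else 0 := by
    intro x
    by_cases hx : x = w
    · subst hx
      simp only [localComplement]
      split_ifs <;> simp_all
    · have hx' : w ≠ x := fun h => hx h.symm
      have hadj : (G.localComplement u).Adj w x ↔ Xor (G.Adj w x) (G.Adj u w ∧ G.Adj u x) :=
        and_iff_right hx'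
      simp only [hadj, hx, if_false, add_zero]
      by_cases h1 : G.Adj w x <;> by_cases h3 : G.Adj u w <;> by_cases h4 : G.Adj u x <;>
        simp [Xor, h1, h3, h4, h2]
  rw [nbrSum, Finset.sum_congr rfl fun x _ => h x, Finset.sum_add_distrib,
    Finset.sum_add_distrib, Finset.sum_ite_eq' Finset.univ w]
  by_cases hw : G.Adj u w <;> simp [hw, nbrSum, add_assoc]

theorem lcMap_lcMap (u : V) (a : V → ZMod 2) : G.lcMap u (G.lcMap u a) = a := by
  classical
  ext w
  have h2 : ∀ b : ZMod 2, b + b = 0 := CharTwo.add_self_eq_zero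
  by_cases hw : w = u
  · subst hw
    have : G.lcMap w (G.lcMap w a) w = a w + G.nbrSum a w + G.nbrSum (G.lcMap w a) w := by
      simp [lcMap]
    rw [this, nbrSum_lcMap_self, add_assoc, h2, add_zero]
  · simp [lcMap, hw]

/-- `lcMap` as a permutation of the index set of the graph code. -/
noncomputable def lcEquiv (u : V) : (V → ZMod 2) ≃ (V → ZMod 2) :=
  ⟨G.lcMap u, G.lcMap u, G.lcMap_lcMap u, G.lcMap_lcMap u⟩

theorem lcMap_self (u : V) (a : V → ZMod 2) : G.lcMap u a u = a u + G.nbrSum a u := by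
  simp [lcMap]

theorem lcMap_of_ne {u w : V} (h : w ≠ u) (a : V → ZMod 2) : G.lcMap u a w = a w := by
  simp [lcMap, h]

open Classical in
theorem nbrSum_localComplement_lcMap (u : V) (a : V → ZMod 2) (w : V) :
    (G.localComplement u).nbrSum (G.lcMap u a) w =
      G.nbrSum a w + if G.Adj u w then a w else 0 := by
  have h2 : ∀ b : ZMod 2, b + b = 0 := CharTwo.add_self_eq_zero
  rw [nbrSum_localComplement, nbrSum_lcMap, nbrSum_lcMap_self]
  split_ifs with h
  · rw [lcMap_of_ne _ h.ne']
    linear_combination h2 (G.nbrSum a u)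
  · simp

theorem zero_iff_localComplement (u : V) (a : V → ZMod 2) (w : V) :
    (G.lcMap u a w = 0 ∧ (G.localComplement u).nbrSum (G.lcMap u a) w = 0) ↔
      (a w = 0 ∧ G.nbrSum a w = 0) := by
  classical
  rw [nbrSum_localComplement_lcMap]
  by_cases hw : w = u
  · subst hw
    simp only [lcMap_self, SimpleGraph.irrefl, if_false, add_zero]
    constructor
    · rintro ⟨h, h'⟩
      exact ⟨by simpa [h'] using h, h'⟩
    · rintro ⟨h, h'⟩
      exact ⟨by simp [h, h'], h'⟩
  · rw [lcMap_of_ne _ hw]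
    constructor
    · rintro ⟨h, h'⟩
      exact ⟨h, by simpa [h] using h'⟩
    · rintro ⟨h, h'⟩
      exact ⟨h, by simp [h, h']⟩

theorem zeroSet_localComplement (u : V) (a : V → ZMod 2) :
    (G.localComplement u).zeroSet (G.lcMap u a) = G.zeroSet a := by
  ext w
  simpa [zeroSet] using G.zero_iff_localComplement u a w

/-- The action on code words of the edge local complementation at `uv`. -/
noncomputable def edgeLcEquiv (u v : V) : (V → ZMod 2) ≃ (V → ZMod 2) :=
  ((G.lcEquiv u).trans ((G.localComplement u).lcEquiv v)).trans
    (((G.localComplement u).localComplement v).lcEquiv u)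

theorem edgeLcEquiv_apply (u v : V) (a : V → ZMod 2) : G.edgeLcEquiv u v a =
    ((G.localComplement u).localComplement v).lcMap u
      ((G.localComplement u).lcMap v (G.lcMap u a)) := rfl

theorem edgeLcEquiv_self {u v : V} (h : G.Adj u v) (a : V → ZMod 2) :
    G.edgeLcEquiv u v a u = G.nbrSum a u := by
  classical
  have h2 : ∀ b : ZMod 2, b + b = 0 := CharTwo.add_self_eq_zero
  have h1 : (G.localComplement u).Adj v u := ((G.localComplement_adj_self u v).2 h).symm
  rw [edgeLcEquiv_apply, lcMap_self, nbrSum_localComplement_lcMap, if_pos h1,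
    nbrSum_localComplement_lcMap, lcMap_of_ne _ h.ne, lcMap_self]
  simp only [SimpleGraph.irrefl, if_false]
  linear_combination h2 (a u) + h2 (G.nbrSum a u)

theorem zero_iff_edgeLocalComplement (u v : V) (a : V → ZMod 2) (w : V) :
    (G.edgeLcEquiv u v a w = 0 ∧ (G.edgeLocalComplement u v).nbrSum (G.edgeLcEquiv u v a) w = 0) ↔
      (a w = 0 ∧ G.nbrSum a w = 0) := by
  rw [edgeLcEquiv_apply, edgeLocalComplement, zero_iff_localComplement, zero_iff_localComplement,
    zero_iff_localComplement]

open Classical in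
theorem codeSum_removeVertex (u : V) : (G.removeVertex u).codeSum =
    ∑ a : V → ZMod 2, if a u = 0 then
      ∏ w : {w // w ≠ u}, (if a w = 0 ∧ G.nbrSum a w = 0 then 3 else 1) else 0 := by
  rw [← (Equiv.funSplitAt u (ZMod 2)).symm.sum_comp, Fintype.sum_prod_type, Finset.sum_comm,
    codeSum]
  refine Finset.sum_congr (by ext; simp) fun b _ => ?_
  rw [Finset.sum_eq_single 0]
  · have hb : ∀ w : {w // w ≠ u}, (Equiv.funSplitAt u (ZMod 2)).symm (0, b) w = b w := by
      intro w
      simp [Equiv.funSplitAt, Equiv.piSplitAt, w.2]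
    have hu : (Equiv.funSplitAt u (ZMod 2)).symm (0, b) u = 0 := by
      simp [Equiv.funSplitAt, Equiv.piSplitAt]
    rw [if_pos hu]
    refine Finset.prod_congr rfl fun w _ => ?_
    have hs : G.nbrSum ((Equiv.funSplitAt u (ZMod 2)).symm (0, b)) w =
        (G.removeVertex u).nbrSum b w := by
      rw [nbrSum, Fintype.sum_eq_add_sum_subtype_ne _ u, hu, nbrSum]
      simp only [ite_self, zero_add, hb]
      rfl
    rw [hb, hs]
  · intro c _ hc
    rw [if_neg]
    simpa [Equiv.funSplitAt, Equiv.piSplitAt] using hc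
  · simp

theorem codeSum_bot : (⊥ : SimpleGraph V).codeSum = 4 ^ Fintype.card V := by
  classical
  have h : ∀ a : V → ZMod 2, ∀ w, (⊥ : SimpleGraph V).nbrSum a w = 0 := by
    intro a w
    simp [nbrSum]
  simp only [codeSum, h, and_true]
  rw [← Fintype.prod_sum (fun (_ : V) (c : ZMod 2) => if c = 0 then 3 else 1)]
  have : ∑ c : ZMod 2, (if c = 0 then 3 else 1) = 4 := by decide
  simp [this]

open Classical in
theorem codeSum_removeVertex_of_equiv {H : SimpleGraph V} (e : (V → ZMod 2) ≃ (V → ZMod 2))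
    (he : ∀ a w, (e a w = 0 ∧ H.nbrSum (e a) w = 0) ↔ (a w = 0 ∧ G.nbrSum a w = 0)) (u : V) :
    (H.removeVertex u).codeSum = ∑ a : V → ZMod 2, if e a u = 0 then
      ∏ w : {w // w ≠ u}, (if a w = 0 ∧ G.nbrSum a w = 0 then 3 else 1) else 0 := by
  rw [codeSum_removeVertex, ← e.sum_comp]
  simp only [he]

open Classical in
theorem codeSum_eq_add {u v : V} (h : G.Adj u v) :
    G.codeSum = (G.removeVertex u).codeSum + ((G.edgeLocalComplement u v).removeVertex u).codeSum
      + ((G.localComplement u).removeVertex u).codeSum := by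
  rw [codeSum_removeVertex,
    G.codeSum_removeVertex_of_equiv (G.edgeLcEquiv u v) (G.zero_iff_edgeLocalComplement u v),
    G.codeSum_removeVertex_of_equiv (G.lcEquiv u) (G.zero_iff_localComplement u),
    ← Finset.sum_add_distrib, ← Finset.sum_add_distrib, codeSum]
  refine Finset.sum_congr (by ext; simp) fun a _ => ?_
  have h3 : G.lcEquiv u a u = a u + G.nbrSum a u := G.lcMap_self u a
  rw [edgeLcEquiv_self G h, h3]
  rw [Fintype.prod_eq_mul_prod_subtype_ne _ u]
  generalize (∏ w : {w // w ≠ u}, if a w = 0 ∧ G.nbrSum a w = 0 then 3 else 1) = p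
  generalize a u = x
  generalize G.nbrSum a u = z
  revert x z
  have key : ∀ x z : ZMod 2, (if x = 0 ∧ z = 0 then 3 else 1) =
      (if x = 0 then 1 else 0) + (if z = 0 then 1 else 0) + (if x + z = 0 then 1 else 0) := by
    decide
  intro x z
  rw [key]
  simp only [add_mul, ite_mul, one_mul, zero_mul]

end

theorem IsInterlaceQ.eval_four {V : Type u} {G : SimpleGraph V} {Q : ℤ[X]}
    (hQ : G.IsInterlaceQ Q) : ∀ [Fintype V], Q.eval 4 = G.codeSum := by
  induction hQ with
  | edgeless =>
    intro _
    simp [codeSum_bot]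
  | @step V G u v huv P₁ P₂ P₃ h₁ h₂ h₃ ih₁ ih₂ ih₃ =>
    intro _
    classical
    rw [eval_add, eval_add, ih₁, ih₂, ih₃, codeSum_eq_add G huv]
    push_cast
    rfl

section

variable {V : Type u} [Fintype V]

theorem codeSum_eq_sum_zeroSet (G : SimpleGraph V) [DecidableEq V] :
    G.codeSum = ∑ a : V → ZMod 2, 3 ^ (G.zeroSet a).card := by
  classical
  rw [codeSum]
  refine Finset.sum_congr (by ext; simp) fun a _ => ?_
  rw [Finset.prod_ite, Finset.prod_const, Finset.prod_const_one, mul_one, zeroSet]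

theorem card_lcMap_lt (G : SimpleGraph V) (a : V → ZMod 2) (u : V) (hu : a u ≠ 0)
    (hz : G.nbrSum a u ≠ 0) :
    (Finset.univ.filter fun w => G.lcMap u a w ≠ 0).card <
      (Finset.univ.filter fun w => a w ≠ 0).card := by
  have key : ∀ x z : ZMod 2, x ≠ 0 → z ≠ 0 → x + z = 0 := by decide
  have h0 : G.lcMap u a u = 0 := by rw [lcMap_self]; exact key _ _ hu hz
  refine Finset.card_lt_card ⟨fun w hw => ?_, fun hs => ?_⟩
  · simp only [Finset.mem_filter, Finset.mem_univ, true_and] at hw ⊢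
    rwa [lcMap_of_ne] at hw
    rintro rfl
    exact hw h0
  · have := hs (by simpa using hu : u ∈ Finset.univ.filter fun w => a w ≠ 0)
    simp [h0] at this

theorem lcMap_ne_zero (G : SimpleGraph V) {a : V → ZMod 2} (ha : a ≠ 0) (u : V) :
    G.lcMap u a ≠ 0 := by
  intro h
  apply ha
  rw [← G.lcMap_lcMap u a, h]
  ext w
  simp [lcMap, nbrSum]

open Classical in
theorem exists_degree_add_card_zeroSet_lt (G : SimpleGraph V) (a : V → ZMod 2) (ha : a ≠ 0) :
    ∃ H ∈ G.lcOrbit, ∃ u, H.degree u + (G.zeroSet a).card < Fintype.card V := by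
  induction hk : (Finset.univ.filter fun w => a w ≠ 0).card using Nat.strong_induction_on
    generalizing G a with
  | _ k ih =>
  subst hk
  obtain ⟨u, hu⟩ := Function.ne_iff.1 ha
  have red : ∀ (G : SimpleGraph V) (b : V → ZMod 2), b ≠ 0 → b u ≠ 0 → G.nbrSum b u ≠ 0 →
      (Finset.univ.filter fun w => b w ≠ 0).card = (Finset.univ.filter fun w => a w ≠ 0).card →
      ∃ H ∈ G.lcOrbit, ∃ u, H.degree u + (G.zeroSet b).card < Fintype.card V := by
    intro G b hb hu hz hc
    obtain ⟨H, hH, w, hw⟩ := ih _ ((G.card_lcMap_lt b u hu hz).trans_eq hc)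
      (G.localComplement u) (G.lcMap u b) (G.lcMap_ne_zero hb u) rfl
    exact ⟨H, mem_lcOrbit_of_localComplement hH, w, by rwa [zeroSet_localComplement] at hw⟩
  by_cases hz : G.nbrSum a u = 0
  · by_cases hN : ∃ w, G.Adj u w ∧ w ∈ G.zeroSet a
    · obtain ⟨w, hw, hwz⟩ := hN
      simp only [zeroSet, Finset.mem_filter, Finset.mem_univ, true_and] at hwz
      have hm : G.lcMap w a = a := by
        ext x
        simp [lcMap, hwz.2]
      obtain ⟨H, hH, x, hx⟩ := red (G.localComplement w) (G.lcMap w a) (G.lcMap_ne_zero ha w)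
        (by rwa [hm]) (by rw [nbrSum_localComplement_lcMap, if_pos hw.symm, hz, zero_add]; exact hu)
        (by rw [hm])
      exact ⟨H, mem_lcOrbit_of_localComplement hH, x, by rwa [zeroSet_localComplement] at hx⟩
    · refine ⟨G, Relation.ReflTransGen.refl, u, ?_⟩
      push Not at hN
      rw [← card_neighborFinset_eq_degree, ← Finset.card_union_of_disjoint, ← Finset.card_univ]
      · refine Finset.card_lt_card (Finset.ssubset_univ_iff.2 fun h => ?_)
        have := h ▸ Finset.mem_univ u
        simp [zeroSet] at this
        exact hu this.1
      · rw [Finset.disjoint_left]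
        intro w hw
        exact hN w (by simpa using hw)
  · exact red G a ha hu hz rfl

theorem lcMinDegree_add_card_zeroSet_lt (G : SimpleGraph V) (a : V → ZMod 2) (ha : a ≠ 0) :
    G.lcMinDegree + (G.zeroSet a).card < Fintype.card V := by
  classical
  obtain ⟨H, hH, u, hu⟩ := G.exists_degree_add_card_zeroSet_lt a ha
  refine lt_of_le_of_lt (Nat.add_le_add_right ?_ _) hu
  refine (Nat.sInf_le (Set.mem_image_of_mem _ hH)).trans ?_
  convert H.minDegree_le_degree u

end

end SimpleGraph

theorem three_pow_le_sum_choose {z c m : ℕ} (hc : z ≤ c) (hm : z < m) :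
    3 ^ z ≤ ∑ s ∈ Finset.range m, c.choose s * 2 ^ s := by
  have h : 3 ^ z = ∑ s ∈ Finset.range (z + 1), z.choose s * 2 ^ s := by
    rw [show 3 = 2 + 1 from rfl, add_pow]
    exact Finset.sum_congr rfl fun s _ => by rw [one_pow, mul_one, Nat.cast_id, mul_comm]
  rw [h]
  exact (Finset.sum_le_sum fun s _ => Nat.mul_le_mul_right _ (Nat.choose_le_choose s hc)).trans
    (Finset.sum_le_sum_of_subset (Finset.range_subset_range.2 hm))

theorem two_pow_mul_sum_le_interlaceGamma (n d : ℕ) :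
    2 ^ n * ∑ k ∈ Finset.Icc 1 n, n.choose k *
      ∑ s ∈ Finset.range (n + 1 - d), (n - k).choose s * 2 ^ s ≤ interlaceGamma n d := by
  have hterm : ∀ k ∈ Finset.Icc 1 n, ∀ s, s ≤ n - k →
      2 ^ n * (n.choose k * ((n - k).choose s * 2 ^ s)) =
        n.choose (k + s) * 2 ^ (k + s) * ((k + s).choose k * 2 ^ (n - k)) := by
    intro k hk s hs
    rw [Finset.mem_Icc] at hk
    have h1 := Nat.choose_mul (n := n) (k := k + s) (s := k) (by omega)
    rw [Nat.add_sub_cancel_left] at h1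
    have h2 : 2 ^ (k + s) * 2 ^ (n - k) = 2 ^ n * 2 ^ s := by
      rw [← pow_add, ← pow_add]; congr 1; omega
    calc _ = (n.choose k * (n - k).choose s) * (2 ^ n * 2 ^ s) := by ring
      _ = (n.choose (k + s) * (k + s).choose k) * (2 ^ (k + s) * 2 ^ (n - k)) := by
        rw [h1, h2]
      _ = _ := by ring
  simp only [interlaceGamma, Finset.mul_sum]
  rw [Finset.sum_sigma', Finset.sum_sigma',
    ← Finset.sum_filter_of_ne (p := fun x : (_ : ℕ) × ℕ => x.2 ≤ n - x.1)]
  · have hinj : Function.Injective fun x : (_ : ℕ) × ℕ => (⟨x.1 + x.2, x.1⟩ : (_ : ℕ) × ℕ) := by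
      rintro ⟨a, b⟩ ⟨a', b'⟩ h
      simp only [Sigma.mk.injEq, heq_eq_eq] at h ⊢
      omega
    have hmem : ∀ x : (_ : ℕ) × ℕ, x ∈ ((Finset.Icc 1 n).sigma
        fun _ => Finset.range (n + 1 - d)).filter (fun x => x.2 ≤ n - x.1) →
        (1 ≤ x.1 ∧ x.1 ≤ n) ∧ x.2 < n + 1 - d ∧ x.2 ≤ n - x.1 := by
      intro x hx
      simpa [and_assoc] using hx
    rw [Finset.sum_congr rfl fun x hx => hterm x.1 (Finset.mem_Icc.2 (hmem x hx).1) x.2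
      (hmem x hx).2.2, ← Finset.sum_image (g := fun x : (_ : ℕ) × ℕ => ⟨x.1 + x.2, x.1⟩)
      (f := fun y : (_ : ℕ) × ℕ => n.choose y.1 * 2 ^ y.1 * (y.1.choose y.2 * 2 ^ (n - y.2)))
      hinj.injOn]
    refine Finset.sum_le_sum_of_subset fun y hy => ?_
    obtain ⟨x, hx, rfl⟩ := Finset.mem_image.1 hy
    have := hmem x hx
    simp only [Finset.mem_sigma, Finset.mem_range, Finset.mem_Icc]
    omega
  · intro x _ hx
    by_contra h
    exact hx (by rw [Nat.choose_eq_zero_of_lt (by omega : n - x.1 < x.2)]; simp)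

theorem sum_card_support_eq {V : Type*} [Fintype V] [DecidableEq V] (f : ℕ → ℕ) :
    ∑ a : V → ZMod 2, f (Finset.univ.filter fun w => a w ≠ 0).card =
      ∑ k ∈ Finset.range (Fintype.card V + 1), (Fintype.card V).choose k * f k := by
  have h := Finset.sum_powerset_apply_card f (x := (Finset.univ : Finset V))
  simp only [smul_eq_mul, Finset.card_univ, Finset.powerset_univ] at h
  rw [← h]
  have h1 : ∀ x : ZMod 2, (if x ≠ 0 then 1 else 0) = x := by decide
  refine Finset.sum_bij' (fun a _ => Finset.univ.filter fun w => a w ≠ 0)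
    (fun S _ w => if w ∈ S then 1 else 0) ?_ ?_ ?_ ?_ ?_
  · simp
  · simp
  · intro a _
    ext w
    simpa using h1 (a w)
  · intro S _
    ext w
    simp
  · simp

namespace SimpleGraph

theorem two_pow_mul_codeSum_le {V : Type*} [Fintype V] (G : SimpleGraph V) :
    2 ^ Fintype.card V * G.codeSum ≤
      interlaceGamma (Fintype.card V) (G.lcMinDegree + 1) + 6 ^ Fintype.card V := by
  classical
  set n := Fintype.card V with hn
  set f : ℕ → ℕ := fun k => if k = 0 then 3 ^ n else
    ∑ s ∈ Finset.range (n + 1 - (G.lcMinDegree + 1)), (n - k).choose s * 2 ^ s with hf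
  have hle : ∀ a : V → ZMod 2,
      3 ^ (G.zeroSet a).card ≤ f (Finset.univ.filter fun w => a w ≠ 0).card := by
    intro a
    by_cases ha : a = 0
    · subst ha
      simpa [hf] using Nat.pow_le_pow_right (by norm_num) (Finset.card_le_univ _)
    · have hz := G.lcMinDegree_add_card_zeroSet_lt a ha
      have h0 : (Finset.univ.filter fun w => a w ≠ 0).card ≠ 0 := by
        rw [Finset.card_ne_zero]
        obtain ⟨u, hu⟩ := Function.ne_iff.1 ha
        exact ⟨u, by simpa using hu⟩
      have hdisj : Disjoint (G.zeroSet a) (Finset.univ.filter fun w => a w ≠ 0) := by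
        rw [Finset.disjoint_left]
        intro w hw
        simp only [zeroSet, Finset.mem_filter] at hw
        simp [hw.2.1]
      have hc := Finset.card_le_univ (G.zeroSet a ∪ Finset.univ.filter fun w => a w ≠ 0)
      rw [Finset.card_union_of_disjoint hdisj] at hc
      simp only [hf, if_neg h0]
      exact three_pow_le_sum_choose (by omega) (by omega)
  calc 2 ^ n * G.codeSum
      ≤ 2 ^ n * ∑ a : V → ZMod 2, f (Finset.univ.filter fun w => a w ≠ 0).card := by
        rw [codeSum_eq_sum_zeroSet]
        exact Nat.mul_le_mul_left _ (Finset.sum_le_sum fun a _ => hle a)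
    _ = 2 ^ n * ∑ k ∈ Finset.Icc 1 n, n.choose k *
        ∑ s ∈ Finset.range (n + 1 - (G.lcMinDegree + 1)), (n - k).choose s * 2 ^ s + 6 ^ n := by
        rw [sum_card_support_eq, ← hn, Finset.range_eq_Ico,
          Finset.sum_eq_sum_Ico_succ_bot (Nat.succ_pos n), mul_add, add_comm]
        congr 1
        · congr 1
          refine Finset.sum_congr rfl fun k hk => ?_
          have := (Finset.mem_Icc.1 hk).1
          simp only [hf, if_neg (by omega : k ≠ 0)]
        · simp [hf, ← mul_pow]
    _ ≤ _ := Nat.add_le_add_right (two_pow_mul_sum_le_interlaceGamma n _) _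

end SimpleGraph

theorem mainTheorem2 {V : Type*} [Fintype V] (G : SimpleGraph V) (n : ℕ)
    (hn : Fintype.card V = n) (Q : Polynomial ℤ) (hQ : G.IsInterlaceQ Q) :
    ((Q.eval 4 : ℤ) : ℝ) ≤ ((interlaceGamma n (G.lcMinDegree + 1) : ℝ) + 6 ^ n) / 2 ^ n := by
  subst hn
  rw [hQ.eval_four, le_div_iff₀ (by positivity), mul_comm]
  exact_mod_cast G.two_pow_mul_codeSum_le
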